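/- For $x,y\in\{0,1\}^n$ let $\Delta(x,y)$ be their Hamming distance. For $c>0$, the communication problem $\mathrm{GHD}_{c,n}$ gives Alice $x\in\{0,1\}^n$ and Bob $y\in\{0,1\}^n$; the required output is $1$ if $\Delta(x,y)\ge n/2+c\sqrt n$, it is $0$ if $\Delta(x,y)\le n/2-c\sqrt n$, and any output is accepted otherwise. In a one-way protocol Alice sends Bob a single message, and Bob then announces the output; the cost is the largest number of bits sent, over all inputs (and all coin tosses). Let $R^{\to}_{\varepsilon}(\mathrm{GHD}_{c,n})$ be the minimum cost of a public-coin randomized one-way protocol that, on every input pair, errs with probability at most $\varepsilon$. For a probability distribution $\rho$ on $\{0,1\}^n\times\{0,1\}^n$, let $D^{\to}_{\rho,\varepsilon}(\mathrm{GHD}_{c,n})$ be the minimum cost of a deterministic one-way protocol that errs with probability at most $\varepsilon$ on a $\rho$-random input pair. Let $\mu_{c,n}$ be the uniform distribution on the set of pairs $(x,y)$ with $|\Delta(x,y)-n/2|\ge c\sqrt n$ (which is non-empty once $\sqrt n\ge 2c$), and let $\mathcal U_n$ be the uniform distribution on $\{0,1\}^n$. **Theorem.** Let $c>0$ be a constant.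 1. For every constant $\varepsilon$ with $0\le\varepsilon<\frac12$, as $n\to\infty$, $$R^{\to}_{\varepsilon}(\mathrm{GHD}_{c,n})=\Omega(n)\qquad\text{and}\qquad D^{\to}_{\mu_{c,n},\varepsilon}(\mathrm{GHD}_{c,n})=\Omega(n).$$ 2. There is a constant $\varepsilon_0>0$, depending only on $c$, such that for every constant $\varepsilon$ with $0\le\varepsilon\le\varepsilon_0$, as $n\to\infty$, $$D^{\to}_{\mathcal U_n\times\mathcal U_n,\varepsilon}(\mathrm{GHD}_{c,n})=\Omega(n).$$ The constants in $\Omega(\cdot)$ may depend on $c$ and $\varepsilon$ only. -/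

import Mathlib

namespace OneWayGHD

noncomputable section

/-- Bit strings of length `n`. -/
abbrev BitString (n : ℕ) : Type := Fin n → Bool

/-- A communication problem on `n`-bit inputs: a partial Boolean function of Alice's input and
Bob's input. The value `none` plays the role of the "don't care" symbol `⋆`. -/
abbrev CommProblem (n : ℕ) : Type := BitString n → BitString n → Option Bool

/-- The output bit `b` matches the value `v`; the "don't care" value matches both bits. -/
def Matches (b : Bool) (v : Option Bool) : Prop := v = none ∨ v = some b

/-- The Gap-Hamming-Distance problem with thresholds `n / 2 ± c √n`. -/
def ghd (c : ℝ) (n : ℕ) : CommProblem n := fun x y =>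
  open Classical in
  if (n : ℝ) / 2 + c * √(n : ℝ) ≤ (hammingDist x y : ℝ) then some true
  else if (hammingDist x y : ℝ) ≤ (n : ℝ) / 2 - c * √(n : ℝ) then some false
  else none

/-- `x` and `y` are `c`-near-orthogonal. -/
def NearOrthogonal (c : ℝ) {n : ℕ} (x y : BitString n) : Prop :=
  |(hammingDist x y : ℝ) - (n : ℝ) / 2| < c * √(n : ℝ)

/-- A deterministic one-way (one-round) protocol: Alice sends one message, a bit string that
depends on her input only; Bob announces the output, given that message and his own input. -/
structure OneWayProtocol (n : ℕ) where
  message : BitString n → List Bool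
  output : List Bool → BitString n → Bool

namespace OneWayProtocol

variable {n : ℕ}

/-- The output of the protocol on the input pair `(x, y)`. -/
def run (P : OneWayProtocol n) (x y : BitString n) : Bool := P.output (P.message x) y

/-- The number of bits sent on a worst-case input. -/
def cost (P : OneWayProtocol n) : ℕ :=
  Finset.univ.sup fun x : BitString n => (P.message x).length

/-- The protocol errs on the input pair `(x, y)`. -/
def Errs (P : OneWayProtocol n) (f : CommProblem n) (x y : BitString n) : Prop :=
  ¬ Matches (P.run x y) (f x y)

end OneWayProtocol

/-- A public-coin randomized one-way protocol, as a probability distribution on deterministic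
one-way protocols: the public random string determines the deterministic protocol to be run. -/
abbrev RandomizedOneWayProtocol (n : ℕ) : Type := PMF (OneWayProtocol n)

/-- At most `s` bits are sent, whatever the inputs and the coin tosses are. -/
def RandomizedOneWayProtocol.CostAtMost {n : ℕ} (P : RandomizedOneWayProtocol n) (s : ℕ) : Prop :=
  ∀ Q ∈ P.support, Q.cost ≤ s

/-- On every input pair the protocol errs with probability at most `ε` over the coin tosses. -/
def RandomizedOneWayProtocol.HasError {n : ℕ} (P : RandomizedOneWayProtocol n)
    (f : CommProblem n) (ε : ℝ) : Prop :=
  ∀ x y : BitString n, (P.toOuterMeasure {Q : OneWayProtocol n | Q.Errs f x y}).toReal ≤ ε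

/-- The `ε`-error one-way randomized communication complexity of `f`: the least worst-case number
of bits sent by a randomized one-way protocol with error `ε`. -/
def randomizedOneWayCC {n : ℕ} (ε : ℝ) (f : CommProblem n) : ℕ :=
  sInf {s : ℕ | ∃ P : RandomizedOneWayProtocol n, P.CostAtMost s ∧ P.HasError f ε}

/-- The `ε`-error distributional deterministic one-way communication complexity of `f` under the
input distribution `ρ`: the least worst-case number of bits sent by a deterministic one-way
protocol whose error probability on a `ρ`-random input pair is at most `ε`. -/
def distributionalOneWayCC {n : ℕ} (ρ : MeasureTheory.Measure (BitString n × BitString n))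
    (ε : ℝ) (f : CommProblem n) : ℕ :=
  sInf {s : ℕ | ∃ P : OneWayProtocol n, P.cost ≤ s ∧ ρ.real {p | P.Errs f p.1 p.2} ≤ ε}

/-- The uniform distribution on the pairs that are not `c`-near-orthogonal, that is, on the
inputs on which the Gap-Hamming-Distance problem prescribes an output. (There is such a pair as
soon as `2 * c ≤ √n`.) -/
def gapUniform (c : ℝ) (n : ℕ) : MeasureTheory.Measure (BitString n × BitString n) :=
  ProbabilityTheory.uniformOn {p | ¬ NearOrthogonal c p.1 p.2}

/-- The uniform distribution on all pairs of `n`-bit inputs. -/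
def pairUniform (n : ℕ) : MeasureTheory.Measure (BitString n × BitString n) :=
  ProbabilityTheory.uniformOn Set.univ

end

end OneWayGHD

namespace OneWayGHD

noncomputable section

open Finset Real

/-! The proof bounds the discrepancy of the sign matrix `ghdMatrix`, whose entry is `gapSign` of `n
- 2Δ`. Two rows `x`, `x'` have a correlation that depends only on `w = x ⊕ x'`. When `w` is nearly
balanced this correlation is small: keep equally many positions `A` outside and `B` inside the
support of `w`. On `A ∪ B` the two sums are `S_A + S_B` and `S_A - S_B`; swapping `A` with `B` fixes
one and negates the other, so by oddness of `gapSign` the restricted correlation is exactly `0`. The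
few dropped positions matter rarely, by a tail bound for their sum and anticoncentration of the kept
sum at the two jumps of `gapSign` (`sum_gapSign_mul_gapSign_bxor_le`).

All but an exponentially small fraction of shifts `w` are nearly balanced. Cauchy–Schwarz on the set
of inputs sharing a message, summed over messages (`sum_sum_mul_le_of_card_lt_le`), then shows that
a protocol of cost at most `δ n` has a negligible surplus of correct over wrong answers on the gap
pairs (`exists_pos_gapSet_card_sub_le`). The gap pairs have positive density
(`exists_pos_le_card_gapSet`), so such a protocol errs on nearly half of them. Averaging over the
coins transfers this to randomized protocols. -/

/-- The sign `(-1) ^ b` of a bit. -/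
def boolSign (b : Bool) : ℝ := if b then -1 else 1

@[simp] theorem boolSign_true : boolSign true = -1 := rfl

@[simp] theorem boolSign_false : boolSign false = 1 := rfl

theorem boolSign_xor (a b : Bool) : boolSign (xor a b) = boolSign a * boolSign b := by
  cases a <;> cases b <;> norm_num [boolSign]

/-! ### Sums of random signs: tails and anticoncentration. -/

section Cube

variable {ι : Type*}

/-- The sum of the signs of the bits of `z` in the positions in `F`. -/
def signSum (F : Finset ι) (z : ι → Bool) : ℝ := ∑ i ∈ F, boolSign (z i)

theorem signSum_eq_card_sub (F : Finset ι) (z : ι → Bool) :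
    signSum F z = (#F : ℝ) - 2 * (#{i ∈ F | z i = true} : ℝ) := by
  have h : ∀ i, boolSign (z i) = 1 - 2 * (if z i = true then (1 : ℝ) else 0) := by
    intro i
    cases z i <;> norm_num [boolSign]
  simp only [signSum, h, sum_sub_distrib, ← mul_sum, sum_const, nsmul_eq_mul, mul_one,
    sum_boole]

/-- The bitwise exclusive or. -/
def bxor (z w : ι → Bool) : ι → Bool := fun i => xor (z i) (w i)

theorem bxor_involutive (w : ι → Bool) : Function.Involutive fun z : ι → Bool => bxor z w := by
  intro z
  funext i
  simp [bxor]

/-- Provides the symmetry of the cube behind the exact cancellation in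
`sum_gapSign_add_mul_gapSign_sub`. -/
theorem exists_perm_map_eq [DecidableEq ι] {A B : Finset ι} (hAB : Disjoint A B) (h : #A = #B) :
    ∃ τ : Equiv.Perm ι, A.map τ.toEmbedding = B ∧ B.map τ.toEmbedding = A := by
  let e : A ≃ B := Finset.equivOfCardEq h
  have hdisj : ∀ {i}, i ∈ B → i ∉ A := fun hi hA => (Finset.disjoint_left.1 hAB hA) hi
  let f : ι → ι := fun i =>
    if hA : i ∈ A then (e ⟨i, hA⟩ : ι) else if hB : i ∈ B then (e.symm ⟨i, hB⟩ : ι) else i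
  have hfA : ∀ i (hA : i ∈ A), f i = e ⟨i, hA⟩ := fun i hA => by simp [f, hA]
  have hfB : ∀ i (hB : i ∈ B), f i = e.symm ⟨i, hB⟩ := fun i hB => by simp [f, hdisj hB, hB]
  have hf : Function.Involutive f := by
    intro i
    by_cases hA : i ∈ A
    · rw [hfA i hA, hfB _ (e ⟨i, hA⟩).2]
      simp
    · by_cases hB : i ∈ B
      · rw [hfB i hB, hfA _ (e.symm ⟨i, hB⟩).2]
        simp
      · simp [f, hA, hB]
  refine ⟨hf.toPerm, ?_, ?_⟩
  · refine eq_of_subset_of_card_le (fun j hj => ?_) (by rw [card_map, h])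
    obtain ⟨i, hi, rfl⟩ := mem_map.1 hj
    change f i ∈ B
    rw [hfA i hi]
    exact (e ⟨i, hi⟩).2
  · refine eq_of_subset_of_card_le (fun j hj => ?_) (by rw [card_map, h])
    obtain ⟨i, hi, rfl⟩ := mem_map.1 hj
    change f i ∈ A
    rw [hfB i hi]
    exact (e.symm ⟨i, hi⟩).2

variable [Fintype ι] [DecidableEq ι]

theorem sum_exp_signSum (F : Finset ι) (l : ℝ) :
    ∑ z : ι → Bool, exp (l * signSum F z) = 2 ^ Fintype.card ι * cosh l ^ #F := by
  have h : ∀ z : ι → Bool,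
      exp (l * signSum F z) = ∏ i, if i ∈ F then exp (l * boolSign (z i)) else 1 := by
    intro z
    rw [signSum, mul_sum, exp_sum, prod_ite_mem, univ_inter]
  simp only [h]
  have h2 := Finset.prod_univ_sum (fun _ : ι => (univ : Finset Bool))
    (fun i b => if i ∈ F then exp (l * boolSign b) else 1)
  rw [Fintype.piFinset_univ] at h2
  rw [← h2]
  have h3 : ∀ i : ι, ∑ b : Bool, (if i ∈ F then exp (l * boolSign b) else 1)
      = 2 * if i ∈ F then cosh l else 1 := by
    intro i
    by_cases hi : i ∈ F
    · simp [hi, cosh_eq]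
      ring
    · simp [hi]
  simp only [h3, prod_mul_distrib, prod_const, prod_ite_mem, univ_inter, card_univ]

/-- Exponential tail bound for the sum of the signs in the positions in `F`. -/
theorem card_le_abs_signSum_le (F : Finset ι) {l m : ℝ} (r : ℝ) (hl : 0 ≤ l) (hm : #F ≤ m) :
    (#{z : ι → Bool | r ≤ |signSum F z|} : ℝ)
      ≤ 2 * 2 ^ Fintype.card ι * exp (l ^ 2 * m / 2 - l * r) := by
  have h1 : (#{z : ι → Bool | r ≤ |signSum F z|} : ℝ) * exp (l * r)
      ≤ ∑ z : ι → Bool, (exp (l * signSum F z) + exp (-l * signSum F z)) := by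
    rw [← nsmul_eq_mul, ← sum_const]
    refine (sum_le_sum (g := fun z => exp (l * signSum F z) + exp (-l * signSum F z)) ?_).trans
      (sum_le_sum_of_subset_of_nonneg (subset_univ _) fun _ _ _ => by positivity)
    intro z hz
    rw [mem_filter] at hz
    rcases le_abs'.1 hz.2 with h | h
    · have : exp (l * r) ≤ exp (-l * signSum F z) := exp_le_exp.2 (by nlinarith)
      linarith [exp_pos (l * signSum F z)]
    · have : exp (l * r) ≤ exp (l * signSum F z) := exp_le_exp.2 (by nlinarith)
      linarith [exp_pos (-l * signSum F z)]
  rw [sum_add_distrib, sum_exp_signSum, sum_exp_signSum, cosh_neg] at h1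
  have h2 : cosh l ^ #F ≤ exp (l ^ 2 * m / 2) := by
    calc cosh l ^ #F ≤ exp (l ^ 2 / 2) ^ #F := by
          exact pow_le_pow_left₀ (cosh_pos l).le (cosh_le_exp_half_sq l) _
      _ = exp (#F * (l ^ 2 / 2)) := (exp_nat_mul _ _).symm
      _ ≤ _ := exp_le_exp.2 (by nlinarith [sq_nonneg l])
  rw [exp_sub, mul_div_assoc', le_div_iff₀ (exp_pos _)]
  refine h1.trans ?_
  rw [← two_mul, ← mul_assoc]
  gcongr

/-- The induction step reduces to `(2m + 1)(2m + 3) ≤ 4(m + 1)²`; the factor `2m + 1` makes it close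
without loss of constants. -/
theorem centralBinom_sq_mul_le (m : ℕ) : Nat.centralBinom m ^ 2 * (2 * m + 1) ≤ 16 ^ m := by
  induction m with
  | zero => simp
  | succ m ih =>
    have h := Nat.succ_mul_centralBinom_succ m
    refine le_of_mul_le_mul_left ?_ (pow_pos m.succ_pos 2)
    calc (m + 1) ^ 2 * (Nat.centralBinom (m + 1) ^ 2 * (2 * (m + 1) + 1))
        = ((m + 1) * Nat.centralBinom (m + 1)) ^ 2 * (2 * m + 3) := by ring
      _ = (Nat.centralBinom m ^ 2 * (2 * m + 1)) * (4 * ((2 * m + 1) * (2 * m + 3))) := by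
          rw [h]; ring
      _ ≤ 16 ^ m * (4 * (4 * (m + 1) ^ 2)) := by
          refine Nat.mul_le_mul ih ?_
          nlinarith
      _ = (m + 1) ^ 2 * 16 ^ (m + 1) := by ring

theorem choose_two_mul_le (m k : ℕ) :
    ((2 * m).choose k : ℝ) * √(2 * m) ≤ 2 ^ (2 * m) := by
  have h : (Nat.centralBinom m : ℝ) ^ 2 * (2 * m + 1) ≤ 16 ^ m := by
    exact_mod_cast centralBinom_sq_mul_le m
  have h0 : ((2 * m).choose k : ℝ) ≤ Nat.centralBinom m := by
    exact_mod_cast Nat.choose_le_centralBinom k m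
  refine (mul_le_mul_of_nonneg_right h0 (sqrt_nonneg _)).trans ?_
  refine abs_le_of_sq_le_sq' ?_ (by positivity) |>.2
  have h16 : ((2 : ℝ) ^ (2 * m)) ^ 2 = 16 ^ m := by
    rw [← pow_mul, mul_right_comm, pow_mul]
    norm_num
  rw [mul_pow, sq_sqrt (by positivity), h16]
  nlinarith [sq_nonneg (Nat.centralBinom m : ℝ)]

theorem card_filter_card_eq_le (F : Finset ι) (k : ℕ) :
    #{z : ι → Bool | #{i ∈ F | z i = true} = k}
      ≤ (#F).choose k * 2 ^ (Fintype.card ι - #F) := by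
  rw [← card_powersetCard, ← card_compl, ← card_powerset, ← card_product]
  refine card_le_card_of_injOn
    (fun z => ({i ∈ F | z i = true}, {i ∈ Fᶜ | z i = true})) ?_ ?_
  · intro z hz
    rw [mem_coe, mem_filter] at hz
    rw [mem_coe, mem_product, mem_powersetCard, mem_powerset]
    exact ⟨⟨filter_subset _ _, hz.2⟩, filter_subset _ _⟩
  · intro z _ z' _ h
    simp only [Prod.mk.injEq, Finset.ext_iff, mem_filter, mem_compl] at h
    funext i
    rw [Bool.eq_iff_iff]
    by_cases hi : i ∈ F
    · have := h.1 i
      tauto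
    · have := h.2 i
      tauto

/-- Anticoncentration of the sum of an even number of signs. -/
theorem card_abs_signSum_sub_le (F : Finset ι) {m : ℕ} (hF : #F = 2 * m) (a : ℝ) {r : ℝ}
    (hr : 0 ≤ r) :
    (#{z : ι → Bool | |signSum F z - a| ≤ r} : ℝ) * √(2 * m)
      ≤ 2 ^ Fintype.card ι * (r + 1) := by
  -- The condition confines the number of true bits in `F` to an interval of length `r`, which holds
  -- at most `r + 1` integers; each value has probability at most `1 / √(2m)`.
  set lo : ℤ := ⌈((#F : ℝ) - a - r) / 2⌉ with hlo
  set hi : ℤ := ⌊((#F : ℝ) - a + r) / 2⌋ with hhi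
  have hsub : ({z : ι → Bool | |signSum F z - a| ≤ r} : Finset _) ⊆
      (Icc lo hi).biUnion fun v => {z : ι → Bool | #{i ∈ F | z i = true} = v.toNat} := by
    intro z hz
    simp only [mem_filter, mem_univ, true_and, signSum_eq_card_sub, abs_le] at hz
    simp only [mem_biUnion, mem_filter, mem_univ, true_and, mem_Icc]
    refine ⟨(#{i ∈ F | z i = true} : ℤ), ⟨?_, ?_⟩, by simp⟩
    · rw [hlo, Int.ceil_le]
      push_cast
      linarith [hz.2]
    · rw [hhi, Int.le_floor]
      push_cast
      linarith [hz.1]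
  have hn : #F ≤ Fintype.card ι := card_le_univ F
  have hcell : ∀ v : ℤ,
      (#{z : ι → Bool | #{i ∈ F | z i = true} = v.toNat} : ℝ) * √(2 * m)
        ≤ 2 ^ Fintype.card ι := by
    intro v
    have h1 : (#{z : ι → Bool | #{i ∈ F | z i = true} = v.toNat} : ℝ)
        ≤ ((#F).choose v.toNat : ℝ) * 2 ^ (Fintype.card ι - #F) := by
      exact_mod_cast card_filter_card_eq_le F v.toNat
    have h2 := choose_two_mul_le m v.toNat
    rw [← hF] at h2
    calc _ ≤ ((#F).choose v.toNat : ℝ) * 2 ^ (Fintype.card ι - #F) * √(2 * m) := by gcongr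
      _ = ((#F).choose v.toNat : ℝ) * √(2 * m) * 2 ^ (Fintype.card ι - #F) := by ring
      _ ≤ 2 ^ #F * 2 ^ (Fintype.card ι - #F) := by gcongr
      _ = 2 ^ Fintype.card ι := by rw [← pow_add, Nat.add_sub_cancel' hn]
  have hcard : (#(Icc lo hi) : ℝ) ≤ r + 1 := by
    rw [Int.card_Icc]
    have h1 : (lo : ℝ) ≥ ((#F : ℝ) - a - r) / 2 := Int.le_ceil _
    have h2 : (hi : ℝ) ≤ ((#F : ℝ) - a + r) / 2 := Int.floor_le _
    rcases le_total 0 (hi + 1 - lo) with h | h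
    · have : (((hi + 1 - lo).toNat : ℤ) : ℝ) = hi + 1 - lo := by
        rw [Int.toNat_of_nonneg h]; push_cast; ring
      rw [Int.cast_natCast] at this
      rw [this]
      linarith
    · rw [Int.toNat_of_nonpos h]
      push_cast
      linarith
  calc (#{z : ι → Bool | |signSum F z - a| ≤ r} : ℝ) * √(2 * m)
      ≤ (∑ v ∈ Icc lo hi, (#{z : ι → Bool | #{i ∈ F | z i = true} = v.toNat} : ℝ))
          * √(2 * m) := by
        gcongr
        exact_mod_cast (card_le_card hsub).trans card_biUnion_le
    _ = ∑ v ∈ Icc lo hi, (#{z : ι → Bool | #{i ∈ F | z i = true} = v.toNat} : ℝ)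
          * √(2 * m) := sum_mul _ _ _
    _ ≤ ∑ _v ∈ Icc lo hi, (2 : ℝ) ^ Fintype.card ι := sum_le_sum fun v _ => hcell v
    _ = 2 ^ Fintype.card ι * #(Icc lo hi) := by rw [sum_const, nsmul_eq_mul, mul_comm]
    _ ≤ _ := by gcongr

/-! ### Correlation of a truncated sign with its shift. -/

/-- The sign of `s` if `|s| ≥ t`, and `0` otherwise. -/
def gapSign (t s : ℝ) : ℝ := if t ≤ s then 1 else if s ≤ -t then -1 else 0

theorem gapSign_neg {t : ℝ} (ht : 0 < t) (s : ℝ) : gapSign t (-s) = -gapSign t s := by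
  unfold gapSign
  split_ifs <;> first | (exfalso; linarith) | norm_num

theorem abs_gapSign_le (t s : ℝ) : |gapSign t s| ≤ 1 := by
  unfold gapSign
  split_ifs <;> norm_num

/-- `gapSign` jumps only at `±t`, so a perturbation smaller than `r` matters only within `r` of a
jump; a change never exceeds `2`. -/
theorem abs_gapSign_add_sub_le (t s u r : ℝ) :
    |gapSign t (s + u) - gapSign t s| ≤
      2 * ((if r ≤ |u| then 1 else 0) + (if |s - t| ≤ r then 1 else 0)
        + (if |s - -t| ≤ r then 1 else 0)) := by
  by_cases hu : r ≤ |u|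
  · have h := abs_sub (gapSign t (s + u)) (gapSign t s)
    have h1 := abs_gapSign_le t (s + u)
    have h2 := abs_gapSign_le t s
    rw [if_pos hu]
    split_ifs <;> linarith
  · rw [if_neg hu]
    have hu' := abs_lt.1 (not_le.1 hu)
    unfold gapSign
    simp only [abs_le]
    split_ifs <;> first | (exfalso; grind) | norm_num

/-- Changing the sum of the signs in `F` to the sum of all signs rarely affects its `gapSign`. -/
theorem sum_abs_gapSign_sub_le (F : Finset ι) {m : ℕ} (hF : #F = 2 * m) (hm : 0 < m)
    {l r b : ℝ} (t : ℝ) (hr : 0 ≤ r) (hl : 0 ≤ l) (hb : Fintype.card ι - 2 * m ≤ b) :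
    ∑ z : ι → Bool, |gapSign t (signSum univ z) - gapSign t (signSum F z)|
      ≤ 2 ^ Fintype.card ι *
        (4 * exp (l ^ 2 * b / 2 - l * r) + 4 * ((r + 1) / √(2 * m))) := by
  have hsum : ∀ z : ι → Bool, signSum univ z = signSum F z + signSum Fᶜ z := fun z =>
    (sum_add_sum_compl F _).symm
  have htail := card_le_abs_signSum_le Fᶜ (l := l) (m := b) r hl (by
    rw [card_compl, Nat.cast_sub (card_le_univ F), hF]
    push_cast
    exact hb)
  have hs : 0 < √(2 * (m : ℝ)) := by positivity
  have hac : ∀ a, (#{z : ι → Bool | |signSum F z - a| ≤ r} : ℝ)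
      ≤ 2 ^ Fintype.card ι * ((r + 1) / √(2 * m)) := by
    intro a
    rw [mul_div_assoc', le_div_iff₀ hs]
    exact card_abs_signSum_sub_le F hF a hr
  calc _ ≤ ∑ z : ι → Bool, 2 * ((if r ≤ |signSum Fᶜ z| then 1 else 0)
        + (if |signSum F z - t| ≤ r then 1 else 0)
        + (if |signSum F z - -t| ≤ r then (1 : ℝ) else 0)) := by
        refine sum_le_sum fun z _ => ?_
        rw [hsum]
        exact abs_gapSign_add_sub_le t _ _ r
    _ = 2 * ((#{z : ι → Bool | r ≤ |signSum Fᶜ z|} : ℝ)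
        + #{z : ι → Bool | |signSum F z - t| ≤ r}
        + #{z : ι → Bool | |signSum F z - -t| ≤ r}) := by
        rw [← mul_sum, sum_add_distrib, sum_add_distrib]
        simp only [sum_boole]
    _ ≤ _ := by
        have h1 := hac t
        have h2 := hac (-t)
        linarith

/-- Exchanging `A` and `B` permutes the cube, fixes the first factor and negates the second, so the
sum equals its own negative. -/
theorem sum_gapSign_add_mul_gapSign_sub {A B : Finset ι} (hAB : Disjoint A B) (h : #A = #B)
    {t : ℝ} (ht : 0 < t) :
    ∑ z : ι → Bool, gapSign t (signSum A z + signSum B z)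
      * gapSign t (signSum A z - signSum B z) = 0 := by
  obtain ⟨τ, hA, hB⟩ := exists_perm_map_eq hAB h
  have hsA : ∀ z : ι → Bool, signSum A (z ∘ τ) = signSum B z := by
    intro z
    rw [signSum, signSum, ← hA, sum_map]
    rfl
  have hsB : ∀ z : ι → Bool, signSum B (z ∘ τ) = signSum A z := by
    intro z
    conv_rhs => rw [signSum, ← hB, sum_map]
    rfl
  have h1 := Equiv.sum_comp (Equiv.arrowCongr τ.symm (Equiv.refl Bool))
    (fun z : ι → Bool => gapSign t (signSum A z + signSum B z)
      * gapSign t (signSum A z - signSum B z))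
  have h2 : ∀ z : ι → Bool, Equiv.arrowCongr τ.symm (Equiv.refl Bool) z = z ∘ τ := by
    intro z
    rfl
  simp only [h2, hsA, hsB] at h1
  have h3 : ∀ z : ι → Bool, gapSign t (signSum B z + signSum A z)
      * gapSign t (signSum B z - signSum A z) = -(gapSign t (signSum A z + signSum B z)
      * gapSign t (signSum A z - signSum B z)) := by
    intro z
    rw [← neg_sub (signSum A z), gapSign_neg ht, add_comm]
    ring
  simp only [h3, sum_neg_distrib] at h1
  linarith

theorem sum_comp_bxor (w : ι → Bool) (φ : (ι → Bool) → ℝ) :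
    ∑ z, φ (bxor z w) = ∑ z, φ z :=
  Equiv.sum_comp (bxor_involutive w).toPerm φ

/-- The `gapSign`s of a random string and of its shift by a nearly balanced string are nearly
uncorrelated. -/
theorem sum_gapSign_mul_gapSign_bxor_le (w : ι → Bool) {l r b t : ℝ} (ht : 0 < t) (hr : 0 ≤ r)
    (hl : 0 ≤ l) (hw : |signSum univ w| ≤ b) (hb : b < Fintype.card ι) :
    ∑ z : ι → Bool, gapSign t (signSum univ z) * gapSign t (signSum univ (bxor z w))
      ≤ 2 ^ Fintype.card ι *
        (8 * exp (l ^ 2 * b / 2 - l * r) + 8 * ((r + 1) / √(Fintype.card ι - b))) := by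
  set D : Finset ι := {i | w i = true} with hD
  set E : Finset ι := {i | ¬ w i = true} with hE
  have hDE : #D + #E = Fintype.card ι := card_filter_add_card_filter_not _
  have hDE' : (#D : ℝ) + #E = Fintype.card ι := by exact_mod_cast hDE
  have hwD : signSum univ w = Fintype.card ι - 2 * (#D : ℝ) := signSum_eq_card_sub univ w
  -- Taking `m` positions from each of `D` and `E` leaves `|#E - #D| = |signSum univ w| ≤ b`
  -- positions out.
  set m := min #D #E with hmdef
  have hmb : (Fintype.card ι : ℝ) - 2 * m ≤ b := by
    rw [hwD, abs_le] at hw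
    rcases min_choice #D #E with h | h <;> rw [hmdef, h] <;> linarith
  have hm : 0 < m := by
    rcases Nat.eq_zero_or_pos m with h | h
    · rw [h] at hmb
      norm_num at hmb
      linarith
    · exact h
  obtain ⟨A, hAE, hA⟩ := exists_subset_card_eq (min_le_right #D #E)
  obtain ⟨B, hBD, hB⟩ := exists_subset_card_eq (min_le_left #D #E)
  have hAB : Disjoint A B :=
    disjoint_of_subset_left hAE (disjoint_of_subset_right hBD
      (disjoint_filter_filter_not univ univ _).symm)
  have hF : #(A ∪ B) = 2 * m := by
    rw [card_union_of_disjoint hAB, hA, hB]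
    omega
  have hz0 : ∑ z : ι → Bool, gapSign t (signSum (A ∪ B) z)
      * gapSign t (signSum (A ∪ B) (bxor z w)) = 0 := by
    rw [← sum_gapSign_add_mul_gapSign_sub hAB (hA.trans hB.symm) ht]
    refine sum_congr rfl fun z _ => ?_
    have e1 : signSum (A ∪ B) z = signSum A z + signSum B z := sum_union hAB
    have e2 : signSum (A ∪ B) (bxor z w) = signSum A z - signSum B z := by
      rw [signSum, sum_union hAB, sub_eq_add_neg, signSum, signSum, ← sum_neg_distrib]
      congr 1
      · refine sum_congr rfl fun i hi => ?_
        have : w i = false := by simpa [hE] using hAE hi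
        simp [bxor, this]
      · refine sum_congr rfl fun i hi => ?_
        have : w i = true := by simpa [hD] using hBD hi
        rw [bxor, boolSign_xor, this]
        simp
    rw [e1, e2]
  have hL := sum_abs_gapSign_sub_le (A ∪ B) hF hm (l := l) (r := r) (b := b) t hr hl hmb
  -- The same truncation error for the shifted string, by translation invariance of the sum over the
  -- cube.
  have hL' := hL
  rw [← sum_comp_bxor w] at hL'
  -- Uses `pq = p'q' + (p - p')q + p'(q - q')` with all factors bounded by `1`.
  have hterm : ∀ z : ι → Bool,
      gapSign t (signSum univ z) * gapSign t (signSum univ (bxor z w))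
        ≤ gapSign t (signSum (A ∪ B) z) * gapSign t (signSum (A ∪ B) (bxor z w))
          + |gapSign t (signSum univ z) - gapSign t (signSum (A ∪ B) z)|
          + |gapSign t (signSum univ (bxor z w)) - gapSign t (signSum (A ∪ B) (bxor z w))| := by
    intro z
    generalize hp : gapSign t (signSum univ z) = p
    generalize hq : gapSign t (signSum univ (bxor z w)) = q
    generalize hp' : gapSign t (signSum (A ∪ B) z) = p'
    generalize hq' : gapSign t (signSum (A ∪ B) (bxor z w)) = q'
    have h1 : |q| ≤ 1 := hq ▸ abs_gapSign_le _ _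
    have h2 : |p'| ≤ 1 := hp' ▸ abs_gapSign_le _ _
    have h3 : (p - p') * q ≤ |p - p'| := by
      refine (le_abs_self _).trans ?_
      rw [abs_mul]
      exact mul_le_of_le_one_right (abs_nonneg _) h1
    have h4 : p' * (q - q') ≤ |q - q'| := by
      refine (le_abs_self _).trans ?_
      rw [abs_mul]
      exact mul_le_of_le_one_left (abs_nonneg _) h2
    linarith
  have hsum := sum_le_sum fun z (_ : z ∈ (univ : Finset (ι → Bool))) => hterm z
  rw [sum_add_distrib, sum_add_distrib, hz0] at hsum
  have hfr : (r + 1) / √(2 * m) ≤ (r + 1) / √(Fintype.card ι - b) := by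
    refine div_le_div_of_nonneg_left (by positivity) (sqrt_pos.2 (by linarith)) ?_
    exact sqrt_le_sqrt (by linarith)
  have hfr' := mul_le_mul_of_nonneg_left hfr (by positivity : (0 : ℝ) ≤ 2 ^ Fintype.card ι)
  linarith

end Cube

/-! ### A lower bound for the upper tail, by the second moment of an exponential. -/

theorem one_add_sq_div_two_le_cosh (u : ℝ) : 1 + u ^ 2 / 2 ≤ cosh u := by
  have h : ∀ v : ℝ, 0 ≤ v → 1 + v ^ 2 / 2 ≤ cosh v := by
    intro v hv
    have h1 : v / 2 ≤ sinh (v / 2) := self_le_sinh_iff.2 (by positivity)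
    have h2 : cosh v = 1 + 2 * sinh (v / 2) ^ 2 := by
      have := cosh_two_mul (v / 2)
      rw [mul_div_cancel₀ v two_ne_zero, cosh_sq] at this
      linarith
    rw [h2]
    nlinarith
  rw [← cosh_abs, ← sq_abs]
  exact h _ (abs_nonneg u)

/-- A sum of `n` random signs is at least `a √n` with probability bounded away from `0`. -/
theorem exists_pos_le_card_le_signSum (a : ℝ) (ha : 0 ≤ a) :
    ∃ p : ℝ, 0 < p ∧ ∀ᶠ n : ℕ in Filter.atTop,
      p * 2 ^ n ≤ (#{z : Fin n → Bool | a * √n ≤ signSum univ z} : ℝ) := by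
  -- This choice gives `l² / 2 = a l + l`, and `exp l > 2`, so the limiting lower bound for the mean
  -- of `exp (u S)` exceeds `2 exp (a l)`.
  set l : ℝ := 2 * a + 2 with hl
  have hl0 : 0 < l := by positivity
  have hlim := tendsto_one_add_div_pow_exp (l ^ 2 / 2)
  have hlt : 2 * exp (a * l) < exp (l ^ 2 / 2) := by
    have e : exp (l ^ 2 / 2) = exp (a * l) * exp l := by
      rw [← exp_add]
      congr 1
      rw [hl]
      ring
    have : 2 < exp l := by
      have := add_one_lt_exp hl0.ne'
      linarith
    rw [e, mul_comm]
    gcongr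
  refine ⟨exp (2 * (a * l)) / exp (2 * l ^ 2), by positivity, ?_⟩
  filter_upwards [hlim.eventually (eventually_gt_nhds hlt), Filter.eventually_gt_atTop 0]
    with n hn hn0
  have hn0' : (0 : ℝ) < n := by exact_mod_cast hn0
  have hs : 0 < √(n : ℝ) := sqrt_pos.2 hn0'
  set u : ℝ := l / √n with hu
  have hu0 : 0 < u := by positivity
  have hu2 : u ^ 2 = l ^ 2 / n := by rw [hu, div_pow, sq_sqrt hn0'.le]
  have hmean : 2 ^ n * (2 * exp (a * l)) ≤ ∑ z : Fin n → Bool, exp (u * signSum univ z) := by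
    rw [sum_exp_signSum, card_univ, Fintype.card_fin]
    gcongr
    refine hn.le.trans (pow_le_pow_left₀ (by positivity) ?_ _)
    have := one_add_sq_div_two_le_cosh u
    rw [hu2] at this
    rwa [div_right_comm]
  have hsq : ∑ z : Fin n → Bool, exp (u * signSum univ z) ^ 2 ≤ 2 ^ n * exp (2 * l ^ 2) := by
    have e : ∀ z : Fin n → Bool,
        exp (u * signSum univ z) ^ 2 = exp ((2 * u) * signSum univ z) := by
      intro z
      rw [← exp_nat_mul]
      congr 1
      push_cast
      ring
    simp only [e]
    rw [sum_exp_signSum, card_univ, Fintype.card_fin]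
    gcongr
    calc cosh (2 * u) ^ n ≤ exp ((2 * u) ^ 2 / 2) ^ n :=
          pow_le_pow_left₀ (cosh_pos _).le (cosh_le_exp_half_sq _) _
      _ = exp (2 * l ^ 2) := by
          rw [← exp_nat_mul, mul_pow, hu2]
          congr 1
          field_simp
  set S : Finset (Fin n → Bool) := {z | a * √n ≤ signSum univ z} with hS
  -- Paley–Zygmund: strings outside `S` account for at most half of the lower bound in `hmean`, so
  -- `S` carries the rest, and Cauchy–Schwarz with `hsq` forces `S` to be large.
  have hlarge : 2 ^ n * exp (a * l) ≤ ∑ z ∈ S, exp (u * signSum univ z) := by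
    have hsplit := sum_add_sum_compl S fun z : Fin n → Bool => exp (u * signSum univ z)
    have hcompl : ∑ z ∈ Sᶜ, exp (u * signSum univ z) ≤ 2 ^ n * exp (a * l) := by
      calc ∑ z ∈ Sᶜ, exp (u * signSum univ z) ≤ ∑ _z ∈ Sᶜ, exp (a * l) := by
            refine sum_le_sum fun z hz => exp_le_exp.2 ?_
            have hz' : signSum univ z ≤ a * √n := by
              simp only [hS, mem_compl, mem_filter, mem_univ, true_and, not_le] at hz
              exact hz.le
            calc u * signSum univ z ≤ u * (a * √n) := by gcongr
              _ = a * l := by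
                rw [hu]
                field_simp
        _ = #Sᶜ * exp (a * l) := by rw [sum_const, nsmul_eq_mul]
        _ ≤ _ := by
            gcongr
            have : #Sᶜ ≤ 2 ^ n := by simpa using card_le_univ Sᶜ
            exact_mod_cast this
    linarith
  have hCS : (∑ z ∈ S, exp (u * signSum univ z)) ^ 2 ≤ #S * (2 ^ n * exp (2 * l ^ 2)) := by
    refine sq_sum_le_card_mul_sum_sq.trans ?_
    gcongr
    exact (sum_le_sum_of_subset_of_nonneg (subset_univ _) fun _ _ _ => by positivity).trans hsq
  have hfin := (pow_le_pow_left₀ (by positivity) hlarge 2).trans hCS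
  have e2 : exp (a * l) ^ 2 = exp (2 * (a * l)) := by
    rw [← exp_nat_mul]
    push_cast
    rfl
  rw [mul_pow, e2] at hfin
  rw [div_mul_eq_mul_div, div_le_iff₀ (exp_pos _)]
  refine le_of_mul_le_mul_left ?_ (by positivity : (0 : ℝ) < 2 ^ n)
  linarith

/-! ### Discrepancy of matrices with mostly uncorrelated rows. -/

section Discrepancy

variable {X Y I : Type*} [Fintype X] [Fintype Y]

/-- If few rows of the matrix `G` have a large correlation with any given row, then `G` has small
discrepancy on the products `A × Y`. -/
theorem sum_mul_sum_le_of_card_lt_le (G : X → Y → ℝ) (hG : ∀ x y, |G x y| ≤ 1) {κ T : ℝ}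
    (hκ : 0 ≤ κ) (hT : 0 ≤ T)
    (hcorr : ∀ x, (#{x' | κ * Fintype.card Y < ∑ y, G x y * G x' y} : ℝ) ≤ T)
    (A : Finset X) (u : Y → ℝ) (hu : ∀ y, |u y| ≤ 1) :
    ∑ y, u y * ∑ x ∈ A, G x y ≤ Fintype.card Y * (√κ * #A + √T * √(#A : ℝ)) := by
  have hK : ∀ x x', ∑ y, G x y * G x' y ≤ Fintype.card Y := by
    intro x x'
    calc ∑ y, G x y * G x' y ≤ ∑ _y : Y, (1 : ℝ) := by
          refine sum_le_sum fun y _ => (le_abs_self _).trans ?_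
          rw [abs_mul]
          exact mul_le_one₀ (hG x y) (abs_nonneg _) (hG x' y)
      _ = Fintype.card Y := by simp
  have hrow : ∀ x, ∑ x' ∈ A, ∑ y, G x y * G x' y ≤ Fintype.card Y * (κ * #A + T) := by
    intro x
    calc ∑ x' ∈ A, ∑ y, G x y * G x' y
        ≤ ∑ x' ∈ A, (κ * Fintype.card Y
          + if κ * Fintype.card Y < ∑ y, G x y * G x' y then (Fintype.card Y : ℝ) else 0) := by
          refine sum_le_sum fun x' _ => ?_
          split_ifs with h
          · have := hK x x'
            have : 0 ≤ κ * Fintype.card Y := by positivity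
            linarith
          · linarith
      _ ≤ #A * (κ * Fintype.card Y) + ∑ x' : X,
          if κ * Fintype.card Y < ∑ y, G x y * G x' y then (Fintype.card Y : ℝ) else 0 := by
          rw [sum_add_distrib, sum_const, nsmul_eq_mul]
          refine add_le_add_right ?_ _
          refine sum_le_sum_of_subset_of_nonneg (subset_univ A) fun x' _ _ => ?_
          split_ifs <;> positivity
      _ ≤ #A * (κ * Fintype.card Y) + T * Fintype.card Y := by
          rw [← sum_filter, sum_const, nsmul_eq_mul]
          gcongr
          exact hcorr x
      _ = _ := by ring
  -- Expanding the square gives the pairwise row correlations; per row, at most `T` partners are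
  -- bounded trivially and the others by `κ`.
  have hsq : ∑ y, (∑ x ∈ A, G x y) ^ 2 ≤ Fintype.card Y * (κ * #A + T) * #A := by
    calc ∑ y, (∑ x ∈ A, G x y) ^ 2 = ∑ x ∈ A, ∑ x' ∈ A, ∑ y, G x y * G x' y := by
          simp only [sq, sum_mul_sum]
          rw [sum_comm]
          exact sum_congr rfl fun x _ => sum_comm
      _ ≤ ∑ _x ∈ A, Fintype.card Y * (κ * #A + T) := sum_le_sum fun x _ => hrow x
      _ = _ := by
          rw [sum_const, nsmul_eq_mul, mul_comm]
  have hmain : ∑ y, u y * ∑ x ∈ A, G x y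
      ≤ √(Fintype.card Y * (Fintype.card Y * (κ * #A + T) * #A)) := by
    refine le_sqrt_of_sq_le ((sum_mul_sq_le_sq_mul_sq _ _ _).trans ?_)
    gcongr
    calc ∑ y, u y ^ 2 ≤ ∑ _y : Y, (1 : ℝ) :=
          sum_le_sum fun y _ => (sq_le_one_iff_abs_le_one _).2 (hu y)
      _ = Fintype.card Y := by simp
  refine hmain.trans (sqrt_le_iff.2 ⟨by positivity, ?_⟩)
  have h1 : √κ ^ 2 = κ := sq_sqrt hκ
  have h2 : √T ^ 2 = T := sq_sqrt hT
  have h3 : √(#A : ℝ) ^ 2 = #A := sq_sqrt (by positivity)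
  have h4 : 0 ≤ √κ * #A * (√T * √(#A : ℝ)) := by positivity
  calc (Fintype.card Y : ℝ) * (Fintype.card Y * (κ * #A + T) * #A)
      = (Fintype.card Y : ℝ) ^ 2 * (√κ ^ 2 * (#A : ℝ) ^ 2 + √T ^ 2 * √(#A : ℝ) ^ 2) := by
        rw [h1, h2, h3]
        ring
    _ ≤ (Fintype.card Y : ℝ) ^ 2 * (√κ * #A + √T * √(#A : ℝ)) ^ 2 := by
        gcongr
        nlinarith
    _ = _ := by ring

/-- The advantage of one-way protocols with few messages is small for a matrix `G` whose rows
are mostly uncorrelated. -/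
theorem sum_sum_mul_le_of_card_lt_le [DecidableEq I] (G : X → Y → ℝ)
    (hG : ∀ x y, |G x y| ≤ 1) {κ T : ℝ} (hκ : 0 ≤ κ) (hT : 0 ≤ T)
    (hcorr : ∀ x, (#{x' | κ * Fintype.card Y < ∑ y, G x y * G x' y} : ℝ) ≤ T)
    (M : X → I) (s : I → Y → ℝ) (hs : ∀ i y, |s i y| ≤ 1) :
    ∑ x, ∑ y, s (M x) y * G x y
      ≤ Fintype.card Y * (√κ * Fintype.card X
        + √T * √(#(univ.image M) * Fintype.card X)) := by
  have hmaps : ∀ x ∈ (univ : Finset X), M x ∈ univ.image M := fun x _ =>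
    mem_image_of_mem M (mem_univ x)
  have hcard : ∑ i ∈ univ.image M, (#{x | M x = i} : ℝ) = Fintype.card X := by
    have := card_eq_sum_card_fiberwise hmaps
    rw [← card_univ, this]
    push_cast
    rfl
  -- Cauchy–Schwarz over messages; this is the only place where their number enters the bound.
  have hsqrt : ∑ i ∈ univ.image M, √(#{x | M x = i} : ℝ)
      ≤ √(#(univ.image M) * Fintype.card X) := by
    refine le_sqrt_of_sq_le (sq_sum_le_card_mul_sum_sq.trans_eq ?_)
    rw [← hcard]
    congr 1
    exact sum_congr rfl fun i _ => sq_sqrt (by positivity)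
  calc ∑ x, ∑ y, s (M x) y * G x y
      = ∑ i ∈ univ.image M, ∑ x with M x = i, ∑ y, s (M x) y * G x y :=
        (sum_fiberwise_of_maps_to hmaps _).symm
    _ = ∑ i ∈ univ.image M, ∑ y, s i y * ∑ x with M x = i, G x y := by
        refine sum_congr rfl fun i _ => ?_
        rw [sum_comm]
        refine sum_congr rfl fun y _ => ?_
        rw [mul_sum]
        refine sum_congr rfl fun x hx => ?_
        rw [(mem_filter.1 hx).2]
    _ ≤ ∑ i ∈ univ.image M, Fintype.card Y * (√κ * #{x | M x = i}
          + √T * √(#{x | M x = i} : ℝ)) :=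
        sum_le_sum fun i _ => sum_mul_sum_le_of_card_lt_le G hG hκ hT hcorr _ _ (hs i)
    _ = Fintype.card Y * (√κ * Fintype.card X
          + √T * ∑ i ∈ univ.image M, √(#{x | M x = i} : ℝ)) := by
        rw [← mul_sum, sum_add_distrib, ← mul_sum, ← mul_sum, hcard]
    _ ≤ _ := by gcongr

end Discrepancy

/-! ### Choice of parameters, and the Gap-Hamming-Distance matrix. -/

theorem exists_pos_sum_gapSign_mul_gapSign_bxor_le {κ : ℝ} (hκ : 0 < κ) :
    ∃ η : ℝ, 0 < η ∧ ∀ᶠ n : ℕ in Filter.atTop, ∀ t : ℝ, 0 < t → ∀ w : Fin n → Bool,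
      |signSum univ w| ≤ 2 * η * n →
      ∑ z : Fin n → Bool, gapSign t (signSum univ z) * gapSign t (signSum univ (bxor z w))
        ≤ κ * 2 ^ n := by
  -- The two error terms will be at most `8θ` and `8 · 4θ`, in total `40θ ≤ κ`. With `r = θ√n`, `l =
  -- A / √n` and `b = 2n / A²` the exponent is `1 - Aθ`; `A` is chosen to make it `-1 / θ`, and `exp
  -- (-1 / θ) ≤ θ`.
  set θ : ℝ := min 1 (κ / 40) with hθ
  have hθ0 : 0 < θ := lt_min one_pos (by positivity)
  have hθ1 : θ ≤ 1 := min_le_left _ _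
  have hθκ : 40 * θ ≤ κ := by
    have := min_le_right 1 (κ / 40)
    rw [← hθ] at this
    linarith
  set A : ℝ := (1 + 1 / θ) / θ with hA
  have hAθ : A * θ = 1 + 1 / θ := by rw [hA]; field_simp
  have hinv : 1 ≤ 1 / θ := (one_le_div hθ0).2 hθ1
  have hA2 : 2 ≤ A := by
    rw [hA, le_div_iff₀ hθ0]
    linarith
  have hA0 : 0 < A := by linarith
  refine ⟨1 / A ^ 2, by positivity, ?_⟩
  have hlim : Filter.Tendsto (fun n : ℕ => √(n : ℝ)) Filter.atTop Filter.atTop :=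
    tendsto_sqrt_atTop.comp tendsto_natCast_atTop_atTop
  filter_upwards [hlim.eventually_ge_atTop (1 / θ), Filter.eventually_gt_atTop 0]
    with n hn hn0 t ht w hw
  have hn0' : (0 : ℝ) < n := by exact_mod_cast hn0
  have hs : 0 < √(n : ℝ) := sqrt_pos.2 hn0'
  have hss : √(n : ℝ) ^ 2 = n := sq_sqrt hn0'.le
  have hη : 1 / A ^ 2 ≤ 1 / 4 := by
    gcongr
    nlinarith
  have hb : 2 * (1 / A ^ 2) * n ≤ n / 2 := by nlinarith
  have h := sum_gapSign_mul_gapSign_bxor_le w (l := A / √n) (r := θ * √n) ht (by positivity)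
    (by positivity) hw (by rw [Fintype.card_fin]; linarith)
  rw [Fintype.card_fin] at h
  have hexp : exp ((A / √n) ^ 2 * (2 * (1 / A ^ 2) * n) / 2 - A / √n * (θ * √n)) ≤ θ := by
    have e : (A / √n) ^ 2 * (2 * (1 / A ^ 2) * n) / 2 - A / √n * (θ * √n) = -(1 / θ) := by
      rw [div_pow, hss]
      have : A / √n * (θ * √n) = A * θ := by field_simp
      rw [this, hAθ]
      field_simp
      ring
    rw [e, exp_neg]
    refine inv_le_of_inv_le₀ hθ0 ?_
    have := add_one_le_exp (1 / θ)
    rw [← one_div]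
    linarith
  have hfrac : (θ * √n + 1) / √(n - 2 * (1 / A ^ 2) * n) ≤ 4 * θ := by
    have hden : √n / 2 ≤ √(n - 2 * (1 / A ^ 2) * n) := by
      refine le_sqrt_of_sq_le ?_
      rw [div_pow, hss]
      linarith
    rw [div_le_iff₀ (lt_of_lt_of_le (by positivity) hden)]
    have h1 : 1 ≤ θ * √n := by
      rw [div_le_iff₀ hθ0] at hn
      linarith
    nlinarith
  refine h.trans ?_
  rw [mul_comm κ]
  gcongr
  linarith

theorem bxor_comm {ι : Type*} (x y : ι → Bool) : bxor x y = bxor y x :=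
  funext fun i => Bool.xor_comm (x i) (y i)

theorem card_bxor {ι : Type*} [Fintype ι] [DecidableEq ι] (x : ι → Bool)
    (p : (ι → Bool) → Prop) [DecidablePred p] :
    #{x' | p (bxor x x')} = #{w | p w} := by
  refine card_nbij' (fun x' => bxor x' x) (fun w => bxor w x) ?_ ?_ ?_ ?_
  · intro x' hx'
    simpa [bxor_comm x] using hx'
  · intro w hw
    have := bxor_involutive x w
    simp only at this
    simpa [bxor_comm x, this] using hw
  · intro x' _
    exact bxor_involutive x x'
  · intro w _
    exact bxor_involutive x w

variable {n : ℕ}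

/-- The matrix of the Gap-Hamming-Distance problem, with entry `-1` for the output `1`, entry `1`
for the output `0`, and entry `0` if the output is not prescribed. -/
def ghdMatrix (c : ℝ) (n : ℕ) (x y : BitString n) : ℝ :=
  gapSign (2 * c * √(n : ℝ)) (signSum univ (bxor x y))

theorem signSum_bxor (x y : BitString n) :
    signSum univ (bxor x y) = n - 2 * (hammingDist x y : ℝ) := by
  rw [signSum_eq_card_sub, card_univ, Fintype.card_fin, hammingDist]
  simp [bxor]

/-- Substituting `y = z ⊕ x` shows that the correlation depends on `x ⊕ x'` alone. -/
theorem sum_ghdMatrix_mul_ghdMatrix (c : ℝ) (x x' : BitString n) :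
    ∑ y, ghdMatrix c n x y * ghdMatrix c n x' y
      = ∑ z : Fin n → Bool, gapSign (2 * c * √(n : ℝ)) (signSum univ z)
        * gapSign (2 * c * √(n : ℝ)) (signSum univ (bxor z (bxor x x'))) := by
  rw [← sum_comp_bxor x]
  refine sum_congr rfl fun z _ => ?_
  have h1 : bxor x (bxor z x) = z := by
    rw [bxor_comm]
    exact bxor_involutive x z
  have h2 : bxor x' (bxor z x) = bxor z (bxor x x') := by
    funext i
    simp only [bxor]
    cases x i <;> cases x' i <;> cases z i <;> rfl
  rw [ghdMatrix, ghdMatrix, h1, h2]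

theorem card_image_le_two_pow_of_length_le {α : Type*} [Fintype α] (f : α → List Bool) {s : ℕ}
    (hf : ∀ a, (f a).length ≤ s) : #(univ.image f) ≤ 2 ^ (s + 1) := by
  have hsub : univ.image f ⊆
      (range (s + 1)).biUnion fun k => univ.image fun v : Fin k → Bool => List.ofFn v := by
    intro m hm
    obtain ⟨a, -, rfl⟩ := mem_image.1 hm
    rw [mem_biUnion]
    refine ⟨(f a).length, mem_range.2 (Nat.lt_succ_of_le (hf a)), mem_image.2 ⟨(f a).get,
      mem_univ _, List.ofFn_get _⟩⟩
  calc #(univ.image f) ≤ ∑ k ∈ range (s + 1), 2 ^ k := by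
        refine (card_le_card hsub).trans (card_biUnion_le.trans (sum_le_sum fun k _ => ?_))
        exact card_image_le.trans (by simp)
    _ ≤ 2 ^ (s + 1) := by
        rw [Nat.geomSum_eq le_rfl]
        simp

theorem OneWayProtocol.length_message_le_cost (Q : OneWayProtocol n) (x : BitString n) :
    (Q.message x).length ≤ Q.cost :=
  Finset.le_sup (f := fun x : BitString n => (Q.message x).length) (mem_univ x)

open Classical in
/-- The input pairs on which the Gap-Hamming-Distance problem prescribes an output. -/
def gapSet (c : ℝ) (n : ℕ) : Finset (BitString n × BitString n) :=
  {p | ¬ NearOrthogonal c p.1 p.2}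

open Classical in
/-- The input pairs on which the protocol errs. -/
def OneWayProtocol.errSet (Q : OneWayProtocol n) (f : CommProblem n) :
    Finset (BitString n × BitString n) :=
  {p | Q.Errs f p.1 p.2}

open Classical in
theorem mem_gapSet {c : ℝ} {p : BitString n × BitString n} :
    p ∈ gapSet c n ↔ 2 * c * √(n : ℝ) ≤ |signSum univ (bxor p.1 p.2)| := by
  have e : (n : ℝ) - 2 * hammingDist p.1 p.2 = -(2 * ((hammingDist p.1 p.2 : ℝ) - n / 2)) := by
    ring
  rw [gapSet, mem_filter, NearOrthogonal, not_lt, signSum_bxor, e, abs_neg, abs_mul, abs_two,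
    mul_assoc]
  simp

open Classical in
theorem OneWayProtocol.mem_errSet {Q : OneWayProtocol n} {f : CommProblem n}
    {p : BitString n × BitString n} : p ∈ Q.errSet f ↔ Q.Errs f p.1 p.2 := by
  simp [OneWayProtocol.errSet]

/-- Signing by the output turns each entry into `1` for a correct answer on a gap pair, `-1` for an
error and `0` elsewhere; the matrix sum is therefore the protocol's advantage. -/
theorem signed_ghdMatrix {c : ℝ} (hc : 0 < c) (hn : 0 < n) (Q : OneWayProtocol n)
    (x y : BitString n) :
    (if Q.output (Q.message x) y then -1 else 1) * ghdMatrix c n x y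
      = (if (x, y) ∈ gapSet c n then 1 else 0)
        - 2 * (if (x, y) ∈ Q.errSet (ghd c n) then (1 : ℝ) else 0) := by
  have ht : 0 < c * √(n : ℝ) := by positivity
  simp only [mem_gapSet, OneWayProtocol.mem_errSet,
    OneWayProtocol.Errs, Matches, OneWayProtocol.run, ghd, ghdMatrix, gapSign, signSum_bxor,
    le_abs', mul_assoc]
  generalize Q.output (Q.message x) y = b
  generalize (hammingDist x y : ℝ) = d
  generalize c * √(n : ℝ) = t at ht
  have h1 : (n : ℝ) / 2 + t ≤ d ↔ n - 2 * d ≤ -(2 * t) := by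
    constructor <;> intro h <;> linarith
  have h2 : d ≤ (n : ℝ) / 2 - t ↔ 2 * t ≤ n - 2 * d := by
    constructor <;> intro h <;> linarith
  simp only [h1, h2]
  by_cases h3 : (n : ℝ) - 2 * d ≤ -(2 * t) <;> by_cases h4 : 2 * t ≤ n - 2 * d
  · exfalso
    linarith
  all_goals cases b <;> simp [h3, h4] <;> norm_num

theorem gapSet_card_sub_eq_sum {c : ℝ} (hc : 0 < c) (hn : 0 < n) (Q : OneWayProtocol n) :
    (#(gapSet c n) : ℝ) - 2 * #(Q.errSet (ghd c n))
      = ∑ x, ∑ y, (if Q.output (Q.message x) y then -1 else 1) * ghdMatrix c n x y := by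
  simp only [signed_ghdMatrix hc hn]
  rw [← Fintype.sum_prod_type' (fun x y => (if (x, y) ∈ gapSet c n then 1 else 0)
        - 2 * (if (x, y) ∈ Q.errSet (ghd c n) then (1 : ℝ) else 0)), sum_sub_distrib, ← mul_sum,
    sum_boole, sum_boole]
  simp

/-- One-way protocols of small linear cost have a small advantage for the Gap-Hamming-Distance
problem on uniformly random inputs. -/
theorem exists_pos_gapSet_card_sub_le {c γ : ℝ} (hc : 0 < c) (hγ : 0 < γ) :
    ∃ δ : ℝ, 0 < δ ∧ ∀ᶠ n : ℕ in Filter.atTop, ∀ Q : OneWayProtocol n, (Q.cost : ℝ) ≤ δ * n →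
      (#(gapSet c n) : ℝ) - 2 * #(Q.errSet (ghd c n)) ≤ γ * (2 ^ n * 2 ^ n) := by
  obtain ⟨η, hη, hcorr⟩ :=
    exists_pos_sum_gapSign_mul_gapSign_bxor_le (κ := (γ / 2) ^ 2) (by positivity)
  -- Up to constants there are at most `exp (η² n)` messages, while the fraction of highly
  -- correlated rows is `exp (-2η² n)`; the product still decays exponentially.
  refine ⟨η ^ 2, by positivity, ?_⟩
  have hlim : Filter.Tendsto (fun n : ℕ => exp (η ^ 2 * (n : ℝ))) Filter.atTop Filter.atTop :=
    tendsto_exp_atTop.comp (tendsto_natCast_atTop_atTop.const_mul_atTop (by positivity))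
  filter_upwards [hcorr, hlim.eventually_ge_atTop (4 / (γ / 2) ^ 2),
    Filter.eventually_gt_atTop 0] with n hcorr hn hn0 Q hQ
  have hn0' : (0 : ℝ) < n := by exact_mod_cast hn0
  have ht : 0 < 2 * c * √(n : ℝ) := by positivity
  have hcardB : (Fintype.card (BitString n) : ℝ) = 2 ^ n := by simp
  set T : ℝ := 2 * 2 ^ n * exp (-(2 * η ^ 2 * n)) with hT
  have hT0 : 0 ≤ T := by positivity
  rw [gapSet_card_sub_eq_sum hc hn0]
  have hfar : ∀ x : BitString n, (#{x' | (γ / 2) ^ 2 * Fintype.card (BitString n)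
      < ∑ y, ghdMatrix c n x y * ghdMatrix c n x' y} : ℝ) ≤ T := by
    intro x
    have hsub : #{x' | (γ / 2) ^ 2 * Fintype.card (BitString n)
        < ∑ y, ghdMatrix c n x y * ghdMatrix c n x' y}
        ≤ #{x' | 2 * η * n ≤ |signSum univ (bxor x x')|} := by
      refine card_le_card fun x' hx' => ?_
      simp only [mem_filter, mem_univ, true_and] at hx' ⊢
      by_contra! hlt
      have := hcorr _ ht (bxor x x') hlt.le
      rw [sum_ghdMatrix_mul_ghdMatrix, hcardB] at hx'
      linarith
    rw [card_bxor x fun w => 2 * η * n ≤ |signSum univ w|] at hsub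
    have htail := card_le_abs_signSum_le (univ : Finset (Fin n)) (l := 2 * η) (m := n)
      (2 * η * n) (by positivity) (by simp)
    rw [Fintype.card_fin] at htail
    calc _ ≤ (#{w : Fin n → Bool | 2 * η * n ≤ |signSum univ w|} : ℝ) := by
          exact_mod_cast hsub
      _ ≤ _ := htail
      _ = T := by
          rw [hT]
          congr 2
          ring
  refine (sum_sum_mul_le_of_card_lt_le (ghdMatrix c n) (fun x y => abs_gapSign_le _ _)
    (sq_nonneg (γ / 2)) hT0 hfar Q.message
    (fun m y => if Q.output m y then -1 else 1) ?_).trans ?_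
  · intro m y
    split_ifs <;> simp
  rw [hcardB, sqrt_sq (by positivity), ← sqrt_mul hT0]
  have hM : (#(univ.image Q.message) : ℝ) ≤ 2 * exp (η ^ 2 * n) := by
    calc (#(univ.image Q.message) : ℝ) ≤ 2 ^ (Q.cost + 1) := by
          exact_mod_cast card_image_le_two_pow_of_length_le Q.message Q.length_message_le_cost
      _ ≤ 2 * exp Q.cost := by
          rw [pow_succ, mul_comm, ← mul_one (Q.cost : ℝ), exp_nat_mul]
          gcongr
          have := add_one_le_exp (1 : ℝ)
          linarith
      _ ≤ _ := by gcongr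
  have hsqrt : √(T * (#(univ.image Q.message) * 2 ^ n)) ≤ γ / 2 * 2 ^ n := by
    refine sqrt_le_iff.2 ⟨by positivity, ?_⟩
    have h4 : 4 ≤ (γ / 2) ^ 2 * exp (η ^ 2 * n) := by
      rw [div_le_iff₀ (by positivity)] at hn
      linarith
    have hexp : exp (-(2 * η ^ 2 * n)) * (exp (η ^ 2 * n) * exp (η ^ 2 * n)) = 1 := by
      rw [← exp_add, ← exp_add]
      ring_nf
      exact exp_zero
    calc T * (#(univ.image Q.message) * 2 ^ n)
        ≤ T * (2 * exp (η ^ 2 * n) * 2 ^ n) := by gcongr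
      _ = 4 * (2 ^ n * 2 ^ n * (exp (-(2 * η ^ 2 * n)) * exp (η ^ 2 * n))) := by
          rw [hT]
          ring
      _ ≤ (γ / 2) ^ 2 * exp (η ^ 2 * n)
            * (2 ^ n * 2 ^ n * (exp (-(2 * η ^ 2 * n)) * exp (η ^ 2 * n))) := by gcongr
      _ = (γ / 2) ^ 2 * (2 ^ n * 2 ^ n)
            * (exp (-(2 * η ^ 2 * n)) * (exp (η ^ 2 * n) * exp (η ^ 2 * n))) := by ring
      _ = (γ / 2 * 2 ^ n) ^ 2 := by
          rw [hexp]
          ring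
  calc (2 : ℝ) ^ n * (γ / 2 * 2 ^ n + √(T * (#(univ.image Q.message) * 2 ^ n)))
      ≤ 2 ^ n * (γ / 2 * 2 ^ n + γ / 2 * 2 ^ n) := by gcongr
    _ = _ := by ring

/-- For each fixed `x`, the strings `y` in the upper tail form a shift of one and the same subset of
the cube. -/
theorem exists_pos_le_card_gapSet {c : ℝ} (hc : 0 < c) :
    ∃ p : ℝ, 0 < p ∧ ∀ᶠ n : ℕ in Filter.atTop, p * (2 ^ n * 2 ^ n) ≤ (#(gapSet c n) : ℝ) := by
  obtain ⟨p, hp, h⟩ := exists_pos_le_card_le_signSum (2 * c) (by positivity)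
  refine ⟨p, hp, ?_⟩
  filter_upwards [h] with n hn
  have hsub : ((univ : Finset (BitString n)).biUnion fun x =>
      ({y : BitString n | 2 * c * √(n : ℝ) ≤ signSum univ (bxor x y)} : Finset _).map
        ⟨Prod.mk x, Prod.mk_right_injective x⟩) ⊆ gapSet c n := by
    intro p hp
    simp only [mem_biUnion, mem_univ, true_and, mem_map, mem_filter] at hp
    obtain ⟨x, y, hy, rfl⟩ := hp
    exact mem_gapSet.2 (hy.trans (le_abs_self _))
  have hcard := card_le_card hsub
  rw [card_biUnion] at hcard
  · simp only [card_map] at hcard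
    rw [sum_congr rfl fun x _ => card_bxor x fun w => 2 * c * √(n : ℝ) ≤ signSum univ w,
      sum_const, smul_eq_mul, card_univ] at hcard
    have hcard' : (2 : ℝ) ^ n * #{w : Fin n → Bool | 2 * c * √(n : ℝ) ≤ signSum univ w}
        ≤ #(gapSet c n) := by
      simp only [Fintype.card_fun, Fintype.card_bool, Fintype.card_fin] at hcard
      exact_mod_cast hcard
    refine le_trans ?_ hcard'
    calc p * (2 ^ n * 2 ^ n) = 2 ^ n * (p * 2 ^ n) := by ring
      _ ≤ _ := by gcongr
  · intro x _ x' _ hxx'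
    simp only [disjoint_left, mem_map]
    rintro _ ⟨y, -, rfl⟩ ⟨y', -, h⟩
    exact hxx' (congrArg Prod.fst h).symm

theorem errSet_subset_gapSet (c : ℝ) (Q : OneWayProtocol n) :
    Q.errSet (ghd c n) ⊆ gapSet c n := by
  intro p hp
  rw [OneWayProtocol.mem_errSet, OneWayProtocol.Errs, Matches, ghd, not_or] at hp
  rw [mem_gapSet, signSum_bxor]
  by_contra! hlt
  rw [abs_lt] at hlt
  refine hp.1 ?_
  rw [if_neg (by linarith), if_neg (by linarith)]

/-! ### From error counts to error probabilities and complexities. -/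

theorem gapUniform_real_errs (c : ℝ) (Q : OneWayProtocol n) :
    (gapUniform c n).real {p | Q.Errs (ghd c n) p.1 p.2}
      = #(Q.errSet (ghd c n)) / #(gapSet c n) := by
  classical
  have h1 : {p : BitString n × BitString n | ¬ NearOrthogonal c p.1 p.2} = gapSet c n := by
    ext p
    simp [gapSet]
  have h2 : {p : BitString n × BitString n | Q.Errs (ghd c n) p.1 p.2}
      = Q.errSet (ghd c n) := by
    ext p
    simp [OneWayProtocol.errSet]
  rw [gapUniform, MeasureTheory.measureReal_def, h1, h2,
    ProbabilityTheory.uniformOn_apply_finset,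
    inter_eq_right.2 (errSet_subset_gapSet c Q)]
  simp

theorem pairUniform_real_errs (c : ℝ) (Q : OneWayProtocol n) :
    (pairUniform n).real {p | Q.Errs (ghd c n) p.1 p.2}
      = #(Q.errSet (ghd c n)) / (2 ^ n * 2 ^ n) := by
  classical
  have h2 : {p : BitString n × BitString n | Q.Errs (ghd c n) p.1 p.2}
      = Q.errSet (ghd c n) := by
    ext p
    simp [OneWayProtocol.errSet]
  rw [pairUniform, MeasureTheory.measureReal_def, h2, ← coe_univ,
    ProbabilityTheory.uniformOn_apply_finset, univ_inter]
  simp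

open Classical in
/-- Every communication problem has an error-free protocol: Alice sends her input. -/
theorem exists_forall_not_errs (f : CommProblem n) :
    ∃ Q : OneWayProtocol n, ∀ x y, ¬ Q.Errs f x y := by
  refine ⟨⟨List.ofFn, fun m y => decide (∃ x, List.ofFn x = m ∧ f x y = some true)⟩,
    fun x y => ?_⟩
  have h : (∃ x', List.ofFn x' = List.ofFn x ∧ f x' y = some true) ↔ f x y = some true :=
    ⟨fun ⟨x', h, hx'⟩ => List.ofFn_injective h ▸ hx', fun hx => ⟨x, rfl, hx⟩⟩
  rw [OneWayProtocol.Errs, OneWayProtocol.run, not_not, Matches]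
  simp only [h]
  rcases f x y with _ | b
  · exact Or.inl rfl
  · cases b <;> simp

/-- The error-free protocol makes the set of admissible costs non-empty, so `sInf` is attained and
is not the default value `0`. -/
theorem exists_cost_le_distributionalOneWayCC
    (ρ : MeasureTheory.Measure (BitString n × BitString n)) {ε : ℝ} (hε : 0 ≤ ε)
    (f : CommProblem n) :
    ∃ Q : OneWayProtocol n, Q.cost ≤ distributionalOneWayCC ρ ε f ∧
      ρ.real {p | Q.Errs f p.1 p.2} ≤ ε := by
  refine Nat.sInf_mem (s := {s : ℕ | ∃ P : OneWayProtocol n, P.cost ≤ s ∧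
    ρ.real {p | P.Errs f p.1 p.2} ≤ ε}) ?_
  obtain ⟨Q, hQ⟩ := exists_forall_not_errs f
  exact ⟨Q.cost, Q, le_rfl, by simpa [hQ] using hε⟩

theorem exists_costAtMost_randomizedOneWayCC {ε : ℝ} (hε : 0 ≤ ε) (f : CommProblem n) :
    ∃ P : RandomizedOneWayProtocol n, P.CostAtMost (randomizedOneWayCC ε f) ∧
      P.HasError f ε := by
  refine Nat.sInf_mem (s := {s : ℕ | ∃ P : RandomizedOneWayProtocol n, P.CostAtMost s ∧
    P.HasError f ε}) ?_
  obtain ⟨Q, hQ⟩ := exists_forall_not_errs f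
  refine ⟨Q.cost, PMF.pure Q, ?_, ?_⟩
  · intro Q' hQ'
    rw [PMF.mem_support_pure_iff] at hQ'
    rw [hQ']
  · intro x y
    simpa [hQ] using hε

open Classical in
/-- If every protocol in the support of `P` errs on at least `B` pairs in `S`, then the error
probability of `P` is at least `B / |S|` on some pair in `S`. -/
theorem RandomizedOneWayProtocol.le_card_mul_of_hasError {P : RandomizedOneWayProtocol n}
    {f : CommProblem n} {ε B : ℝ} (hε : 0 ≤ ε) (hP : P.HasError f ε)
    (S : Finset (BitString n × BitString n))
    (hB : ∀ Q ∈ P.support, B ≤ #{p ∈ S | Q.Errs f p.1 p.2}) : B ≤ #S * ε := by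
  have hpoint : ∀ p : BitString n × BitString n,
      P.toOuterMeasure {Q : OneWayProtocol n | Q.Errs f p.1 p.2} ≤ ENNReal.ofReal ε := by
    intro p
    have htop : P.toOuterMeasure {Q : OneWayProtocol n | Q.Errs f p.1 p.2} ≠ ⊤ := by
      rw [PMF.toOuterMeasure_apply]
      exact PMF.tsum_coe_indicator_ne_top P _
    rw [← ENNReal.ofReal_toReal htop]
    exact ENNReal.ofReal_le_ofReal (hP p.1 p.2)
  -- The easy direction of Yao's principle: exchange the sum over pairs with the average over coins.
  have hlow : ENNReal.ofReal B
      ≤ ∑ p ∈ S, P.toOuterMeasure {Q : OneWayProtocol n | Q.Errs f p.1 p.2} := by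
    calc ENNReal.ofReal B = ∑' Q, P Q * ENNReal.ofReal B := by
          rw [ENNReal.tsum_mul_right, P.tsum_coe, one_mul]
      _ ≤ ∑' Q, ∑ p ∈ S, {Q : OneWayProtocol n | Q.Errs f p.1 p.2}.indicator P Q := by
          refine ENNReal.tsum_le_tsum fun Q => ?_
          by_cases hQ : Q ∈ P.support
          · have h1 := ENNReal.ofReal_le_ofReal (hB Q hQ)
            rw [ENNReal.ofReal_natCast] at h1
            refine (mul_le_mul_right h1 (P Q)).trans_eq ?_
            simp only [Set.indicator_apply, Set.mem_ofPred_eq]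
            rw [← sum_filter, sum_const, nsmul_eq_mul, mul_comm]
          · rw [(P.apply_eq_zero_iff Q).2 hQ, zero_mul]
            exact zero_le
      _ = _ := by
          rw [Summable.tsum_finsetSum fun _ _ => ENNReal.summable]
          simp only [PMF.toOuterMeasure_apply]
  have h := hlow.trans (sum_le_sum fun p _ => hpoint p)
  rw [sum_const, nsmul_eq_mul, ← ENNReal.ofReal_natCast,
    ← ENNReal.ofReal_mul (by positivity)] at h
  exact (ENNReal.ofReal_le_ofReal_iff (by positivity)).1 h

theorem isBigO_natCast_of_eventually_lt {f : ℕ → ℕ} {δ : ℝ} (hδ : 0 < δ)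
    (h : ∀ᶠ n : ℕ in Filter.atTop, δ * n < f n) :
    (fun n : ℕ => (n : ℝ)) =O[Filter.atTop] fun n => (f n : ℝ) := by
  refine Asymptotics.IsBigO.of_bound (1 / δ) ?_
  filter_upwards [h] with n hn
  rw [norm_natCast, norm_natCast, one_div_mul_eq_div, le_div_iff₀ hδ]
  linarith

end

end OneWayGHD

open OneWayGHD in
theorem mainTheorem4 (c : ℝ) (hc : 0 < c) :
    (∀ ε : ℝ, 0 ≤ ε → ε < 1 / 2 →
      (fun n : ℕ => (n : ℝ)) =O[Filter.atTop]
          (fun n : ℕ => (randomizedOneWayCC ε (ghd c n) : ℝ)) ∧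
      (fun n : ℕ => (n : ℝ)) =O[Filter.atTop]
          (fun n : ℕ => (distributionalOneWayCC (gapUniform c n) ε (ghd c n) : ℝ))) ∧
    (∃ ε₀ : ℝ, 0 < ε₀ ∧ ∀ ε : ℝ, 0 ≤ ε → ε ≤ ε₀ →
      (fun n : ℕ => (n : ℝ)) =O[Filter.atTop]
          (fun n : ℕ => (distributionalOneWayCC (pairUniform n) ε (ghd c n) : ℝ))) := by
  classical
  obtain ⟨p, hp, hgap⟩ := exists_pos_le_card_gapSet hc
  -- Under the uniform distribution errors occur only on gap pairs, of density at least `p`; error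
  -- `p / 4` still leaves an advantage of `p / 2`, above the bound `γ = p / 4` used below.
  refine ⟨fun ε hε hε2 => ?_, p / 4, by positivity, fun ε hε hεp => ?_⟩
  · have h12 : 0 < 1 - 2 * ε := by linarith
    obtain ⟨δ, hδ, hadv⟩ :=
      -- Error `ε` on the gap pairs means an advantage of at least `(1 - 2ε) p` relative to all
      -- pairs; `γ` is half of that.
      exists_pos_gapSet_card_sub_le hc (γ := p * (1 - 2 * ε) / 2) (by positivity)
    refine ⟨isBigO_natCast_of_eventually_lt hδ ?_, isBigO_natCast_of_eventually_lt hδ ?_⟩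
    · filter_upwards [hgap, hadv] with n hgap hadv
      obtain ⟨P, hcost, herr⟩ := exists_costAtMost_randomizedOneWayCC hε (ghd c n)
      by_contra! hle
      have h := RandomizedOneWayProtocol.le_card_mul_of_hasError hε herr (gapSet c n)
        (B := ((Finset.card (gapSet c n) : ℝ) - p * (1 - 2 * ε) / 2 * (2 ^ n * 2 ^ n)) / 2)
        fun Q hQ => by
          have h1 := hadv Q (le_trans (by exact_mod_cast hcost Q hQ) hle)
          have h2 : Q.errSet (ghd c n)
              ⊆ (gapSet c n).filter fun p => Q.Errs (ghd c n) p.1 p.2 := fun q hq =>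
            Finset.mem_filter.2
              ⟨errSet_subset_gapSet c Q hq, OneWayProtocol.mem_errSet.1 hq⟩
          have h3 : (Finset.card (Q.errSet (ghd c n)) : ℝ) ≤ Finset.card
              ((gapSet c n).filter fun p => Q.Errs (ghd c n) p.1 p.2) := by
            exact_mod_cast Finset.card_le_card h2
          linarith
      have hN : (0 : ℝ) < p * (2 ^ n * 2 ^ n) := by positivity
      nlinarith
    · filter_upwards [hgap, hadv] with n hgap hadv
      obtain ⟨Q, hcost, herr⟩ :=
        exists_cost_le_distributionalOneWayCC (gapUniform c n) hε (ghd c n)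
      by_contra! hle
      have h1 := hadv Q (le_trans (by exact_mod_cast hcost) hle)
      have hN : (0 : ℝ) < p * (2 ^ n * 2 ^ n) := by positivity
      rw [gapUniform_real_errs, div_le_iff₀ (by linarith)] at herr
      nlinarith
  · obtain ⟨δ, hδ, hadv⟩ := exists_pos_gapSet_card_sub_le hc (γ := p / 4) (by positivity)
    refine isBigO_natCast_of_eventually_lt hδ ?_
    filter_upwards [hgap, hadv] with n hgap hadv
    obtain ⟨Q, hcost, herr⟩ :=
      exists_cost_le_distributionalOneWayCC (pairUniform n) hε (ghd c n)
    by_contra! hle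
    have h1 := hadv Q (le_trans (by exact_mod_cast hcost) hle)
    have hN : (0 : ℝ) < 2 ^ n * 2 ^ n := by positivity
    rw [pairUniform_real_errs, div_le_iff₀ hN] at herr
    nlinarith
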